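/- Let $T>0$ and $\lambda>0$. Write $v(p)=p(1+|p|^2)^{-1/2}$ for $p\in\mathbb R^3$, and let $L^1_{kin}(\mathbb R^6)$ be the set of $g\in L^1(\mathbb R^3_x\times\mathbb R^3_p)$ with $g\ge 0$ and $\iint\sqrt{1+|p|^2}\,g\,dx\,dp<\infty$. Let $f_0\in L^1_{kin}\cap L^\infty(\mathbb R^6)$ and $E_0,B_0\in[L^2(\mathbb R^3)]^3$, and let $(f,E,B)$ be a weak solution on $[0,T[$ of the relativistic Vlasov--Maxwell system $$\partial_t f+v\cdot\nabla_x f+(E+v\times B)\cdot\nabla_p f=0,\qquad \partial_tE-\nabla\times B=-4\pi j,\qquad \partial_tB+\nabla\times E=0,\qquad \nabla\cdot E=4\pi\rho,\quad \nabla\cdot B=0,$$ $$\rho(t,x)=\int_{\mathbb R^3} f(t,x,p)\,dp,\qquad j(t,x)=\int_{\mathbb R^3} v(p)f(t,x,p)\,dp,$$ with initial data $(f_0,E_0,B_0)$. That is, $f\in L^\infty([0,T[;L^1_{kin}\cap L^\infty(\mathbb R^6))$ (in particular $\iint\sqrt{1+|p|^2}f(t)\,dx\,dp$ and $\|f(t)\|_{L^\infty}$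 are essentially bounded in $t$), $E,B\in[L^\infty([0,T[;L^2(\mathbb R^3))]^3$, and the equations hold in the sense of distributions with smooth test functions compactly supported in $[0,T[\times\mathbb R^6$ (respectively $[0,T[\times\mathbb R^3$), the initial data entering through the boundary term at $t=0$; for the Vlasov equation this means $$\int_0^T\!\!\int_{\mathbb R^6} f\,\big[\partial_t\varphi+v\cdot\nabla_x\varphi+(E+v\times B)\cdot\nabla_p\varphi\big]\,dx\,dp\,dt=-\int_{\mathbb R^6}f_0(x,p)\,\varphi(0,x,p)\,dx\,dp$$ for all such $\varphi$. Suppose that $E,B\in[L^1(]0,T[;BV_{loc}(\mathbb R^3))]^3$, i.e. for each component $u$ of $E$ and $B$ and every $R>0$ the norm $\|u(t)\|_{L^1(B_R)}+|\nabla u(t)|(B_R)$ is integrable over $t\in{}]0,T[$, and that $$\rho_\lambda(t,x):=\int_{\mathbb R^3}|p|^\lambda f(t,x,p)\,dp$$ belongs to $L^\infty(]0,T[;L^2(\mathbb R^3))$. Then $E\cdot j\in L^1(]0,T[\times\mathbb R^3)$, and for almost all $t\in[0,T[$ $$\int_{\mathbb R^3\times\mathbb R^3}\sqrt{1+|p|^2}\,f(t,x,p)\,dx\,dp=\int_{\mathbb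 R^3\times\mathbb R^3}\sqrt{1+|p|^2}\,f_0(x,p)\,dx\,dp+\int_0^t\!\int_{\mathbb R^3}E\cdot j\,dx\,ds .$$ -/

import Mathlib

open MeasureTheory Set
open scoped ENNReal NNReal ContDiff

noncomputable section

namespace RVM

/-- Three-dimensional Euclidean space (positions, momenta, field values). -/
abbrev V3 : Type := EuclideanSpace ℝ (Fin 3)

/-- The `i`-th standard unit vector. -/
def e (i : Fin 3) : V3 := EuclideanSpace.single i (1 : ℝ)

/-- The vector product on `V3`. -/
def cross (a b : V3) : V3 := WithLp.toLp 2 (crossProduct (WithLp.ofLp a) (WithLp.ofLp b))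

/-- The particle energy `√(1 + |p|²)`. -/
def energy (p : V3) : ℝ := Real.sqrt (1 + ‖p‖ ^ 2)

/-- The relativistic velocity `v = p (1 + |p|²)^{-1/2}`. -/
def vel (p : V3) : V3 := (energy p)⁻¹ • p

/-- The Lorentz force `K = E + v × B`. -/
def lorentz (E B : ℝ → V3 → V3) (t : ℝ) (x p : V3) : V3 := E t x + cross (vel p) (B t x)

/-- The charge density `ρ = ∫ f dp`; here `f t (x, p)` is the distribution function. -/
def rho (f : ℝ → V3 × V3 → ℝ) (t : ℝ) (x : V3) : ℝ := ∫ p : V3, f t (x, p)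

/-- The current density `j = ∫ v f dp`. -/
def current (f : ℝ → V3 × V3 → ℝ) (t : ℝ) (x : V3) : V3 := ∫ p : V3, f t (x, p) • vel p

/-- The moment `ρ_lam = ∫ |p|^lam f dp` of a nonnegative `f`, with values in `[0, ∞]`, so that it
is infinite (and not zero) where the integral diverges. -/
def rhoMoment (lam : ℝ) (f : ℝ → V3 × V3 → ℝ) (t : ℝ) (x : V3) : ℝ≥0∞ :=
  ∫⁻ p : V3, ENNReal.ofReal (‖p‖ ^ lam * f t (x, p))

/-- `L¹_kin(ℝ⁶)`: nonnegative integrable functions with finite kinetic energy. -/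
structure MemL1Kin (g : V3 × V3 → ℝ) : Prop where
  integrable : Integrable g
  nonneg : ∀ᵐ z, 0 ≤ g z
  energy_integrable : Integrable (fun z : V3 × V3 => energy z.2 * g z)

/-- `f ∈ L^∞([0,T[; L¹_kin ∩ L^∞(ℝ⁶))`. As `1 ≤ √(1+|p|²)`, the bound on the kinetic energy also
bounds the `L¹` norm. -/
structure MemLinftyKin (T : ℝ) (f : ℝ → V3 × V3 → ℝ) : Prop where
  measurable : AEStronglyMeasurable (fun z : ℝ × V3 × V3 => f z.1 z.2)
    ((volume.restrict (Ioo 0 T)).prod volume)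
  mem : ∀ᵐ t ∂(volume.restrict (Ioo 0 T)), MemL1Kin (f t) ∧ MemLp (f t) ⊤
  bound : ∃ C : ℝ≥0, ∀ᵐ t ∂(volume.restrict (Ioo 0 T)),
    ∫ z : V3 × V3, energy z.2 * f t z ≤ C ∧ eLpNorm (f t) ⊤ volume ≤ C

/-- `u ∈ [L^∞([0,T[; L²(ℝ³))]³`. -/
structure MemLinftyL2 (T : ℝ) (u : ℝ → V3 → V3) : Prop where
  measurable : AEStronglyMeasurable (fun z : ℝ × V3 => u z.1 z.2)
    ((volume.restrict (Ioo 0 T)).prod volume)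
  bound : ∃ C : ℝ≥0, ∀ᵐ t ∂(volume.restrict (Ioo 0 T)), eLpNorm (u t) 2 volume ≤ C

/-- Test functions: smooth with compact support in `[0,T[ × X`, written as restrictions of
smooth compactly supported functions on `ℝ × X` that vanish near and after time `T`. They need not
vanish at time `0`. -/
structure IsTest {X Y : Type*} [NormedAddCommGroup X] [NormedSpace ℝ X]
    [NormedAddCommGroup Y] [NormedSpace ℝ Y] (T : ℝ) (φ : ℝ × X → Y) : Prop where
  smooth : ContDiff ℝ ∞ φ
  compact : HasCompactSupport φ
  support : tsupport φ ⊆ Iio T ×ˢ univ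

/-- The time derivative of a function of `(t, x)`. -/
def dt {Y : Type*} [NormedAddCommGroup Y] [NormedSpace ℝ Y] (φ : ℝ × V3 → Y) (t : ℝ) (x : V3) : Y :=
  fderiv ℝ φ (t, x) (1, 0)

/-- The partial derivative in the `i`-th space direction of a function of `(t, x)`. -/
def dx {Y : Type*} [NormedAddCommGroup Y] [NormedSpace ℝ Y] (i : Fin 3) (φ : ℝ × V3 → Y)
    (t : ℝ) (x : V3) : Y :=
  fderiv ℝ φ (t, x) (0, e i)

/-- The spatial gradient. -/
def grad (φ : ℝ × V3 → ℝ) (t : ℝ) (x : V3) : V3 :=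
  WithLp.toLp 2 (fun i => dx i φ t x)

/-- The spatial curl. -/
def curl (Φ : ℝ × V3 → V3) (t : ℝ) (x : V3) : V3 :=
  !₂[dx 1 Φ t x 2 - dx 2 Φ t x 1, dx 2 Φ t x 0 - dx 0 Φ t x 2, dx 0 Φ t x 1 - dx 1 Φ t x 0]

/-- `∂ₜ f + v·∇ₓ f + K·∇ₚ f = 0`, `f(0) = f₀` in the sense of distributions on `[0,T[ × ℝ⁶`. The
directional derivatives are `∂ₜφ`, `v·∇ₓφ` and `K·∇ₚφ`. -/
def VlasovWeak (T : ℝ) (f₀ : V3 × V3 → ℝ) (f : ℝ → V3 × V3 → ℝ) (E B : ℝ → V3 → V3) : Prop :=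
  ∀ φ : ℝ × V3 × V3 → ℝ, IsTest T φ →
    ∫ t in Ioo 0 T, ∫ z : V3 × V3, f t z *
        (fderiv ℝ φ (t, z) (1, 0, 0) + fderiv ℝ φ (t, z) (0, vel z.2, 0)
          + fderiv ℝ φ (t, z) (0, 0, lorentz E B t z.1 z.2))
      = - ∫ z : V3 × V3, f₀ z * φ (0, z)

/-- `∂ₜ E - ∇ × B = -4π j`, `E(0) = E₀` in the sense of distributions. -/
def AmpereWeak (T : ℝ) (E₀ : V3 → V3) (f : ℝ → V3 × V3 → ℝ) (E B : ℝ → V3 → V3) : Prop :=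
  ∀ Φ : ℝ × V3 → V3, IsTest T Φ →
    ∫ t in Ioo 0 T, ∫ x : V3, (inner ℝ (E t x) (dt Φ t x) + inner ℝ (B t x) (curl Φ t x)
        - 4 * Real.pi * inner ℝ (current f t x) (Φ (t, x)))
      = - ∫ x : V3, inner ℝ (E₀ x) (Φ (0, x))

/-- `∂ₜ B + ∇ × E = 0`, `B(0) = B₀` in the sense of distributions. -/
def FaradayWeak (T : ℝ) (B₀ : V3 → V3) (E B : ℝ → V3 → V3) : Prop :=
  ∀ Φ : ℝ × V3 → V3, IsTest T Φ →
    ∫ t in Ioo 0 T, ∫ x : V3, (inner ℝ (B t x) (dt Φ t x) - inner ℝ (E t x) (curl Φ t x))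
      = - ∫ x : V3, inner ℝ (B₀ x) (Φ (0, x))

/-- `∇ · E = 4π ρ` in the sense of distributions. -/
def GaussElectricWeak (T : ℝ) (f : ℝ → V3 × V3 → ℝ) (E : ℝ → V3 → V3) : Prop :=
  ∀ φ : ℝ × V3 → ℝ, IsTest T φ →
    ∫ t in Ioo 0 T, ∫ x : V3, inner ℝ (E t x) (grad φ t x)
      = - ∫ t in Ioo 0 T, ∫ x : V3, 4 * Real.pi * rho f t x * φ (t, x)

/-- `∇ · B = 0` in the sense of distributions. -/
def GaussMagneticWeak (T : ℝ) (B : ℝ → V3 → V3) : Prop :=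
  ∀ φ : ℝ × V3 → ℝ, IsTest T φ →
    ∫ t in Ioo 0 T, ∫ x : V3, inner ℝ (B t x) (grad φ t x) = 0

/-- `(f, E, B)` is a weak solution on `[0,T[` of the relativistic Vlasov-Maxwell system with
initial data `(f₀, E₀, B₀)`. -/
structure IsWeakSolution (T : ℝ) (f₀ : V3 × V3 → ℝ) (E₀ B₀ : V3 → V3)
    (f : ℝ → V3 × V3 → ℝ) (E B : ℝ → V3 → V3) : Prop where
  f_mem : MemLinftyKin T f
  E_mem : MemLinftyL2 T E
  B_mem : MemLinftyL2 T B
  vlasov : VlasovWeak T f₀ f E B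
  ampere : AmpereWeak T E₀ f E B
  faraday : FaradayWeak T B₀ E B
  gaussElectric : GaussElectricWeak T f E
  gaussMagnetic : GaussMagneticWeak T B

/-- The divergence of a vector field on `ℝ³`. -/
def divergence (φ : V3 → V3) (x : V3) : ℝ := ∑ i : Fin 3, fderiv ℝ φ x (e i) i

/-- The variation of `u` in the open set `Ω`: the supremum of `∫_Ω u div φ` over smooth vector
fields `φ` with compact support in `Ω` and `|φ| ≤ 1`; it is the total mass of `|∇u|` on `Ω`. -/
def variation (u : V3 → ℝ) (Ω : Set V3) : ℝ≥0∞ :=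
  ⨆ (φ : V3 → V3) (_ : ContDiff ℝ ∞ φ ∧ HasCompactSupport φ ∧ tsupport φ ⊆ Ω ∧ ∀ x, ‖φ x‖ ≤ 1),
    ENNReal.ofReal (∫ x in Ω, u x * divergence φ x)

/-- `u ∈ BV_loc(ℝ³)`. -/
structure MemBVLoc (u : V3 → ℝ) : Prop where
  locallyIntegrable : LocallyIntegrable u
  variation_lt_top : ∀ R : ℝ, 0 < R → variation u (Metric.ball 0 R) < ⊤

/-- `u ∈ L¹(]0,T[; BV_loc(ℝ³))`: the norm of `u(t)` in `BV(B_R)` is integrable in time for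
every radius `R`. -/
structure MemL1BVLoc (T : ℝ) (u : ℝ → V3 → ℝ) : Prop where
  measurable : AEStronglyMeasurable (fun z : ℝ × V3 => u z.1 z.2)
    ((volume.restrict (Ioo 0 T)).prod volume)
  mem : ∀ᵐ t ∂(volume.restrict (Ioo 0 T)), MemBVLoc (u t)
  norm_integrable : ∀ R : ℝ, 0 < R →
    ∫⁻ t in Ioo 0 T,
      (eLpNorm (u t) 1 (volume.restrict (Metric.ball 0 R)) + variation (u t) (Metric.ball 0 R)) < ⊤

end RVM

end

/-!
The energy balance is the Vlasov equation tested with the particle energy, `φ = θ(t) √(1 + |p|²)`.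
Since `∇ₚ √(1 + |p|²) = v` is orthogonal to `v × B`, only the electric field does work and
`K · ∇ₚ φ = θ E · v`. This `φ` has no compact support in `(x, p)`, so it is approximated by its
products with smooth cutoffs `χₙ`; the gradients of `χₙ √(1 + |p|²)` are bounded uniformly in `n`,
and dominated convergence applies since `√(1 + |p|²) f`, `|E| f` and `|B| f` are integrable. For
`|E| f` this follows from `|E| f ≤ f + |E|² ‖f‖_∞` where `|p| < 1`, and from `f ≤ |p|^λ f` and the
Cauchy-Schwarz inequality for `|E|` and `ρ_λ` where `|p| ≥ 1`. In the limit the kinetic energy has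
the distributional derivative `∫ E · j dx` with the prescribed initial value, hence agrees almost
everywhere with the primitive.
-/

namespace RVM

section WeakDerivative

variable {a b : ℝ} {F : Type*} [NormedAddCommGroup F] [NormedSpace ℝ F]

lemma integrableOn_Icc_const_add_primitive (hab : a ≤ b) {J : ℝ → F}
    (hJ : IntegrableOn J (Icc a b)) (c : F) :
    IntegrableOn (fun t => c + ∫ s in a..t, J s) (Icc a b) := by
  refine ContinuousOn.integrableOn_Icc (continuousOn_const.add ?_)
  rw [← uIcc_of_le hab] at hJ ⊢
  exact intervalIntegral.continuousOn_primitive_interval hJ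

variable [CompleteSpace F]

lemma integral_antideriv_smul_eq_integral_smul_primitive {g : ℝ → ℝ} {J : ℝ → F}
    (hg : IntegrableOn g (Icc a b)) (hJ : IntegrableOn J (Icc a b)) :
    ∫ t in Icc a b, (∫ s in t..b, g s) • J t = ∫ s in Icc a b, g s • ∫ t in a..s, J t := by
  set G : ℝ → ℝ → F := fun t s => {y : ℝ × ℝ | y.1 < y.2}.indicator (fun y => g y.2 • J y.1) (t, s)
  have hG : Integrable (Function.uncurry G)
      ((volume.restrict (Icc a b)).prod (volume.restrict (Icc a b))) :=
    (Integrable.smul_prod hg hJ).swap.indicator (measurableSet_lt measurable_fst measurable_snd)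
  have hG_left : ∀ t ∈ Icc a b, ∫ s in Icc a b, G t s = (∫ s in t..b, g s) • J t := by
    intro t ht
    have hset : Ioi t ∩ Icc a b = Ioc t b := by
      ext s; simp only [mem_inter_iff, mem_Ioi, mem_Icc, mem_Ioc]; grind
    rw [intervalIntegral.integral_of_le ht.2, ← integral_smul_const, ← hset,
      ← Measure.restrict_restrict measurableSet_Ioi, ← integral_indicator measurableSet_Ioi]
    rfl
  have hG_right : ∀ s ∈ Icc a b, ∫ t in Icc a b, G t s = g s • ∫ t in a..s, J t := by
    intro s hs
    have hset : Iio s ∩ Icc a b = Ico a s := by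
      ext t; simp only [mem_inter_iff, mem_Iio, mem_Icc, mem_Ico]; grind
    rw [intervalIntegral.integral_of_le hs.1, integral_Ioc_eq_integral_Ioo,
      ← integral_Ico_eq_integral_Ioo, ← integral_smul, ← hset,
      ← Measure.restrict_restrict measurableSet_Iio, ← integral_indicator measurableSet_Iio]
    rfl
  rw [← setIntegral_congr_fun measurableSet_Icc hG_left,
    ← setIntegral_congr_fun measurableSet_Icc hG_right]
  exact integral_integral_swap hG

lemma exists_contDiff_eqOn_antideriv (hab : a < b) {g : ℝ → ℝ} (hg : ContDiff ℝ ∞ g)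
    (hgc : HasCompactSupport g) (hgs : tsupport g ⊆ Ioo a b) :
    ∃ θ : ℝ → ℝ, ContDiff ℝ ∞ θ ∧ HasCompactSupport θ ∧ tsupport θ ⊆ Iio b ∧
      ∀ t ∈ Icc a b, θ t = -∫ s in t..b, g s ∧ deriv θ t = g t := by
  set Θ : ℝ → ℝ := fun t => ∫ s in b..t, g s
  have hΘ_deriv : ∀ t, HasDerivAt Θ (g t) t := fun t =>
    intervalIntegral.integral_hasDerivAt_right (hg.continuous.intervalIntegrable _ _)
      (hg.continuous.stronglyMeasurableAtFilter _ _) hg.continuous.continuousAt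
  have hΘ_smooth : ContDiff ℝ ∞ Θ := by
    rw [contDiff_infty_iff_deriv, funext fun t => (hΘ_deriv t).deriv]
    exact ⟨fun t => (hΘ_deriv t).differentiableAt, hg⟩
  obtain ⟨b', hb', hmax⟩ := (hgc.isCompact.insert a).exists_isGreatest (insert_nonempty _ _)
  have hb'b : b' < b := hb'.elim (fun h => h ▸ hab) fun h => (hgs h).2
  have hΘ_zero : ∀ t, b' < t → Θ t = 0 := fun t ht => by
    refine intervalIntegral.integral_zero_ae (.of_forall fun s hs => ?_)
    refine image_eq_zero_of_notMem_tsupport fun hmem => ?_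
    exact ((lt_min hb'b ht).trans hs.1).not_ge (hmax (mem_insert_of_mem a hmem))
  let η : ContDiffBump ((a + b) / 2) := ⟨(b - a) / 2 + 1, (b - a) / 2 + 2, by linarith, by linarith⟩
  have hηΘ : ∀ t ∈ Icc a b, (fun s => η s * Θ s) =ᶠ[nhds t] Θ := fun t ht => by
    have hmem : t ∈ Metric.ball ((a + b) / 2) η.rIn := by
      rw [Metric.mem_ball, Real.dist_eq, abs_lt]
      change -((b - a) / 2 + 1) < _ ∧ _ < (b - a) / 2 + 1
      constructor <;> linarith [ht.1, ht.2]
    filter_upwards [η.eventuallyEq_one_of_mem_ball hmem] with s hs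
    rw [hs, Pi.one_apply, one_mul]
  refine ⟨fun t => η t * Θ t, η.contDiff.mul hΘ_smooth, η.hasCompactSupport.mul_right,
    (closure_minimal (fun t ht => ?_) isClosed_Iic).trans (Iic_subset_Iio.2 hb'b),
    fun t ht => ⟨(hηΘ t ht).eq_of_nhds.trans (intervalIntegral.integral_symm _ _),
      (hηΘ t ht).deriv_eq.trans (hΘ_deriv t).deriv⟩⟩
  by_contra hbt
  exact ht (mul_eq_zero_of_right _ (hΘ_zero t (not_le.1 hbt)))

lemma integral_smul_eq_integral_smul_add_primitive (hab : a < b) {K J : ℝ → F} {c : F}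
    (hK : IntegrableOn K (Icc a b)) (hJ : IntegrableOn J (Icc a b))
    (h : ∀ θ : ℝ → ℝ, ContDiff ℝ ∞ θ → HasCompactSupport θ → tsupport θ ⊆ Iio b →
      ∫ t in Icc a b, (deriv θ t • K t + θ t • J t) = -(θ a • c))
    {g : ℝ → ℝ} (hg : ContDiff ℝ ∞ g) (hgc : HasCompactSupport g) (hgs : tsupport g ⊆ Ioo a b) :
    ∫ t in Icc a b, g t • K t = ∫ t in Icc a b, g t • (c + ∫ s in a..t, J s) := by
  obtain ⟨θ, hθ, hθc, hθb, hθg⟩ := exists_contDiff_eqOn_antideriv hab hg hgc hgs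
  have hmul {u : ℝ → ℝ} {v : ℝ → F} (hu : Continuous u) (hv : IntegrableOn v (Icc a b)) :
      IntegrableOn (fun t => u t • v t) (Icc a b) :=
    hv.continuousOn_smul hu.continuousOn isCompact_Icc
  have hweak : (∫ t in Icc a b, g t • K t) + ∫ t in Icc a b, θ t • J t = -(θ a • c) := by
    rw [← h θ hθ hθc hθb, ← integral_add (hmul hg.continuous hK) (hmul hθ.continuous hJ)]
    exact setIntegral_congr_fun measurableSet_Icc fun t ht => by simp only [(hθg t ht).2]
  have hparts : ∫ t in Icc a b, θ t • J t = -∫ t in Icc a b, g t • ∫ s in a..t, J s := by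
    rw [← integral_antideriv_smul_eq_integral_smul_primitive hg.continuous.integrableOn_Icc hJ,
      ← integral_neg]
    exact setIntegral_congr_fun measurableSet_Icc fun t ht => by
      simp only [(hθg t ht).1, neg_smul]
  have hinitial : -(θ a • c) = ∫ t in Icc a b, g t • c := by
    rw [(hθg a (left_mem_Icc.2 hab.le)).1, neg_smul, neg_neg, integral_smul_const,
      intervalIntegral.integral_of_le hab.le, integral_Icc_eq_integral_Ioc]
  have hP : IntegrableOn (fun t => ∫ s in a..t, J s) (Icc a b) := by
    simpa only [zero_add] using integrableOn_Icc_const_add_primitive hab.le hJ 0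
  simp_rw [smul_add]
  rw [integral_add (hmul hg.continuous (integrableOn_const (by simp))) (hmul hg.continuous hP),
    ← hinitial, ← hweak, hparts, neg_add_cancel_right]

theorem ae_eq_add_integral_of_weak_deriv (hab : a < b) {K J : ℝ → F} {c : F}
    (hK : IntegrableOn K (Ioo a b)) (hJ : IntegrableOn J (Ioo a b))
    (h : ∀ θ : ℝ → ℝ, ContDiff ℝ ∞ θ → HasCompactSupport θ → tsupport θ ⊆ Iio b →
      ∫ t in Ioo a b, (deriv θ t • K t + θ t • J t) = -(θ a • c)) :
    ∀ᵐ t ∂(volume.restrict (Ioo a b)), K t = c + ∫ s in a..t, J s := by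
  simp_rw [← integral_Icc_eq_integral_Ioo] at h
  rw [← integrableOn_Icc_iff_integrableOn_Ioo] at hK hJ
  have hcP := integrableOn_Icc_const_add_primitive hab.le hJ c
  have hzero : ∀ᵐ t, t ∈ Ioo a b → K t - (c + ∫ s in a..t, J s) = 0 := by
    refine isOpen_Ioo.ae_eq_zero_of_integral_contDiff_smul_eq_zero
      (f := fun t => K t - (c + ∫ s in a..t, J s))
      ((hK.sub hcP).mono_set Ioo_subset_Icc_self).locallyIntegrableOn fun g hg hgc hgs => ?_
    have hmul {v : ℝ → F} (hv : IntegrableOn v (Icc a b)) :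
        IntegrableOn (fun t => g t • v t) (Icc a b) :=
      hv.continuousOn_smul hg.continuous.continuousOn isCompact_Icc
    rw [← setIntegral_eq_integral_of_forall_compl_eq_zero (s := Icc a b) fun t ht => by
      rw [image_eq_zero_of_notMem_tsupport fun hmem => ht (Ioo_subset_Icc_self (hgs hmem)),
        zero_smul]]
    simp_rw [smul_sub]
    rw [integral_sub (hmul hK) (hmul hcP), sub_eq_zero]
    exact integral_smul_eq_integral_smul_add_primitive hab hK hJ h hg hgc hgs
  rw [ae_restrict_iff' measurableSet_Ioo]
  exact hzero.mono fun t ht hmem => sub_eq_zero.1 (ht hmem)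

end WeakDerivative

section Cutoff

variable {X : Type*} [NormedAddCommGroup X] [NormedSpace ℝ X] [FiniteDimensional ℝ X]

/-- The fixed profile of the cutoffs: a smooth function equal to `1` on the unit ball and to `0`
outside the ball of radius `2`. -/
noncomputable def unitBump (X : Type*) [NormedAddCommGroup X] [NormedSpace ℝ X]
    [FiniteDimensional ℝ X] : ContDiffBump (0 : X) :=
  ⟨1, 2, one_pos, one_lt_two⟩

/-- The smooth cutoff at radius `n + 1`, used to approximate test functions without compact
support. -/
noncomputable def cutoff (n : ℕ) (x : X) : ℝ := unitBump X ((n + 1 : ℝ)⁻¹ • x)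

lemma contDiff_cutoff (n : ℕ) : ContDiff ℝ ∞ (cutoff n : X → ℝ) :=
  (unitBump X).contDiff.comp (contDiff_const_smul _)

lemma hasCompactSupport_cutoff (n : ℕ) : HasCompactSupport (cutoff n : X → ℝ) :=
  (unitBump X).hasCompactSupport.comp_smul (by positivity)

lemma norm_cutoff_le_one (n : ℕ) (x : X) : ‖cutoff n x‖ ≤ 1 :=
  (Real.norm_of_nonneg (unitBump X).nonneg).trans_le (unitBump X).le_one

lemma cutoff_eventuallyEq_one {n : ℕ} {x : X} (h : ‖x‖ < n + 1) : cutoff n =ᶠ[nhds x] 1 := by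
  have hmem : (n + 1 : ℝ)⁻¹ • x ∈ Metric.ball (0 : X) (unitBump X).rIn := by
    rw [mem_ball_zero_iff, norm_smul, norm_inv, Real.norm_of_nonneg (by positivity)]
    exact (inv_mul_lt_one₀ (by positivity)).2 h
  exact (continuous_const_smul _).continuousAt.eventually
    ((unitBump X).eventuallyEq_one_of_mem_ball hmem)

lemma eventually_cutoff_eventuallyEq_one (x : X) :
    ∀ᶠ n : ℕ in Filter.atTop, cutoff n =ᶠ[nhds x] 1 := by
  filter_upwards [tendsto_natCast_atTop_atTop.eventually_gt_atTop ‖x‖] with n hn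
  exact cutoff_eventuallyEq_one (hn.trans (lt_add_one _))

lemma exists_one_add_norm_mul_norm_fderiv_cutoff_le :
    ∃ K : ℝ, ∀ (n : ℕ) (x : X), (1 + ‖x‖) * ‖fderiv ℝ (cutoff n) x‖ ≤ K := by
  have hcont : Continuous fun y : X => (1 + ‖y‖) * ‖fderiv ℝ (unitBump X) y‖ :=
    (continuous_const.add continuous_norm).mul
      ((unitBump X).contDiff.continuous_fderiv one_ne_zero).norm
  obtain ⟨K, hK⟩ := hcont.bounded_above_of_compact_support
    ((unitBump X).hasCompactSupport.fderiv (𝕜 := ℝ)).norm.mul_left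
  refine ⟨K, fun n x => ?_⟩
  have hs : ‖(n + 1 : ℝ)⁻¹‖ ≤ 1 := by
    rw [norm_inv, Real.norm_of_nonneg (by positivity)]
    exact inv_le_one_of_one_le₀ (by linarith [n.cast_nonneg (α := ℝ)])
  calc (1 + ‖x‖) * ‖fderiv ℝ (cutoff n) x‖
      = (‖(n + 1 : ℝ)⁻¹‖ + ‖(n + 1 : ℝ)⁻¹ • x‖)
          * ‖fderiv ℝ (unitBump X) ((n + 1 : ℝ)⁻¹ • x)‖ := by
        unfold cutoff
        rw [fderiv_comp_smul, norm_smul, norm_smul]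
        ring
    _ ≤ (1 + ‖(n + 1 : ℝ)⁻¹ • x‖) * ‖fderiv ℝ (unitBump X) ((n + 1 : ℝ)⁻¹ • x)‖ := by gcongr
    _ ≤ K := (le_abs_self _).trans (hK _)

end Cutoff

section EnergyVelocity

lemma one_le_energy (p : V3) : 1 ≤ energy p :=
  Real.one_le_sqrt.2 (le_add_of_nonneg_right (sq_nonneg _))

lemma energy_pos (p : V3) : 0 < energy p := one_pos.trans_le (one_le_energy p)

lemma contDiff_energy : ContDiff ℝ ∞ energy :=
  (contDiff_const.add (contDiff_norm_sq ℝ)).sqrt fun p => by positivity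

lemma norm_le_energy (p : V3) : ‖p‖ ≤ energy p :=
  Real.le_sqrt_of_sq_le (le_add_of_nonneg_left zero_le_one)

lemma energy_le_one_add_norm (p : V3) : energy p ≤ 1 + ‖p‖ :=
  Real.sqrt_le_iff.2 ⟨by positivity, by nlinarith [norm_nonneg p]⟩

lemma continuous_vel : Continuous vel :=
  (contDiff_energy.continuous.inv₀ fun p => (energy_pos p).ne').smul continuous_id

lemma norm_vel_le_one (p : V3) : ‖vel p‖ ≤ 1 := by
  rw [vel, norm_smul, norm_inv, Real.norm_of_nonneg (energy_pos p).le,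
    inv_mul_le_one₀ (energy_pos p)]
  exact norm_le_energy p

lemma hasFDerivAt_energy (p : V3) : HasFDerivAt energy (innerSL ℝ (vel p)) p := by
  have hsq : HasFDerivAt (fun q : V3 => 1 + ‖q‖ ^ 2) (2 • innerSL ℝ p) p :=
    (hasStrictFDerivAt_norm_sq p).hasFDerivAt.const_add 1
  refine (hsq.sqrt (by positivity)).congr_fderiv ?_
  rw [vel, map_smul, ← Nat.cast_smul_eq_nsmul ℝ, smul_smul, energy]
  congr 1
  push_cast
  ring

end EnergyVelocity

section LorentzForce

lemma inner_cross_self_left (a b : V3) : inner ℝ a (cross a b) = 0 := by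
  rw [cross, EuclideanSpace.inner_eq_star_dotProduct, star_trivial, dotProduct_comm]
  exact dot_self_cross _ _

lemma norm_cross_sq (a b : V3) : ‖cross a b‖ ^ 2 = ‖a‖ ^ 2 * ‖b‖ ^ 2 - inner ℝ a b ^ 2 := by
  simp only [← real_inner_self_eq_norm_sq, EuclideanSpace.inner_eq_star_dotProduct, star_trivial,
    cross, cross_dot_cross]
  rw [dotProduct_comm b.ofLp a.ofLp]
  ring

lemma norm_cross_le (a b : V3) : ‖cross a b‖ ≤ ‖a‖ * ‖b‖ := by
  rw [← sq_le_sq₀ (norm_nonneg _) (by positivity), mul_pow, norm_cross_sq]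
  exact sub_le_self _ (sq_nonneg _)

lemma continuous_cross : Continuous fun q : V3 × V3 => cross q.1 q.2 := by
  refine (PiLp.continuous_toLp 2 _).comp (continuous_pi fun i => ?_)
  fin_cases i <;> simp only [cross_apply] <;> exact by fun_prop

lemma norm_lorentz_le (E B : ℝ → V3 → V3) (t : ℝ) (x p : V3) :
    ‖lorentz E B t x p‖ ≤ ‖E t x‖ + ‖B t x‖ :=
  calc ‖lorentz E B t x p‖
      ≤ ‖E t x‖ + ‖vel p‖ * ‖B t x‖ := (norm_add_le _ _).trans (by gcongr; exact norm_cross_le _ _)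
    _ ≤ ‖E t x‖ + ‖B t x‖ := by
      gcongr
      exact mul_le_of_le_one_left (norm_nonneg _) (norm_vel_le_one p)

lemma inner_vel_lorentz (E B : ℝ → V3 → V3) (t : ℝ) (x p : V3) :
    inner ℝ (vel p) (lorentz E B t x p) = inner ℝ (E t x) (vel p) := by
  rw [lorentz, inner_add_right, inner_cross_self_left, add_zero, real_inner_comm]

end LorentzForce

section TruncatedEnergy

/-- The particle energy as a function on phase space, truncated to a smooth compactly supported
function. -/
noncomputable def truncatedEnergy (n : ℕ) (z : V3 × V3) : ℝ := cutoff n z * energy z.2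

lemma contDiff_truncatedEnergy (n : ℕ) : ContDiff ℝ ∞ (truncatedEnergy n) :=
  (contDiff_cutoff n).mul (contDiff_energy.comp contDiff_snd)

lemma hasCompactSupport_truncatedEnergy (n : ℕ) : HasCompactSupport (truncatedEnergy n) :=
  (hasCompactSupport_cutoff n).mul_right

lemma norm_truncatedEnergy_le (n : ℕ) (z : V3 × V3) : ‖truncatedEnergy n z‖ ≤ energy z.2 := by
  rw [truncatedEnergy, norm_mul, Real.norm_of_nonneg (energy_pos _).le]
  exact mul_le_of_le_one_left (energy_pos _).le (norm_cutoff_le_one n z)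

lemma hasFDerivAt_energy_snd (z : V3 × V3) :
    HasFDerivAt (fun y : V3 × V3 => energy y.2)
      ((innerSL ℝ (vel z.2)).comp (ContinuousLinearMap.snd ℝ V3 V3)) z :=
  (hasFDerivAt_energy z.2).comp z hasFDerivAt_snd

lemma eventually_truncatedEnergy_eventuallyEq (z : V3 × V3) :
    ∀ᶠ n : ℕ in Filter.atTop, truncatedEnergy n =ᶠ[nhds z] fun y => energy y.2 := by
  filter_upwards [eventually_cutoff_eventuallyEq_one z] with n hn
  filter_upwards [hn] with y hy
  rw [truncatedEnergy, hy, Pi.one_apply, one_mul]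

-- The derivative of the cutoff decays like `1 / n` where it does not vanish, which compensates the
-- linear growth of the energy.
lemma exists_norm_fderiv_truncatedEnergy_le :
    ∃ K : ℝ, ∀ (n : ℕ) (z : V3 × V3), ‖fderiv ℝ (truncatedEnergy n) z‖ ≤ K := by
  obtain ⟨K, hK⟩ := exists_one_add_norm_mul_norm_fderiv_cutoff_le (X := V3 × V3)
  refine ⟨1 + K, fun n z => ?_⟩
  have hderiv : fderiv ℝ (truncatedEnergy n) z
      = cutoff n z • (innerSL ℝ (vel z.2)).comp (ContinuousLinearMap.snd ℝ V3 V3)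
        + energy z.2 • fderiv ℝ (cutoff n) z :=
    (((contDiff_cutoff n).differentiable (by simp) z).hasFDerivAt.mul
      (hasFDerivAt_energy_snd z)).fderiv
  have henergy : energy z.2 ≤ 1 + ‖z‖ :=
    (energy_le_one_add_norm _).trans (by gcongr; exact norm_snd_le z)
  rw [hderiv]
  refine norm_add_le_of_le ?_ ?_
  · calc ‖cutoff n z • (innerSL ℝ (vel z.2)).comp (ContinuousLinearMap.snd ℝ V3 V3)‖
        ≤ 1 * (1 * 1) := by
          rw [norm_smul]
          gcongr
          · exact norm_cutoff_le_one n z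
          · refine (ContinuousLinearMap.opNorm_comp_le _ _).trans ?_
            gcongr
            · exact (innerSL_apply_norm ℝ _).trans_le (norm_vel_le_one _)
            · exact ContinuousLinearMap.norm_snd_le ℝ V3 V3
      _ = 1 := by norm_num
  · rw [norm_smul, Real.norm_of_nonneg (energy_pos _).le]
    exact (mul_le_mul_of_nonneg_right henergy (norm_nonneg _)).trans (hK n z)

/-- The admissible test function `θ(t) χ_n(x, p) √(1 + |p|²)` with which the energy balance is read
off from the Vlasov equation. -/
noncomputable def energyTest (θ : ℝ → ℝ) (n : ℕ) (y : ℝ × V3 × V3) : ℝ :=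
  θ y.1 * truncatedEnergy n y.2

variable {θ : ℝ → ℝ}

lemma contDiff_energyTest (hθ : ContDiff ℝ ∞ θ) (n : ℕ) : ContDiff ℝ ∞ (energyTest θ n) :=
  (hθ.comp contDiff_fst).mul ((contDiff_truncatedEnergy n).comp contDiff_snd)

lemma isTest_energyTest {T : ℝ} (hθ : ContDiff ℝ ∞ θ) (hθc : HasCompactSupport θ)
    (hθT : tsupport θ ⊆ Iio T) (n : ℕ) : IsTest T (energyTest θ n) := by
  have hsupp : tsupport (energyTest θ n) ⊆ tsupport θ ×ˢ tsupport (truncatedEnergy n) :=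
    closure_minimal (fun y hy => ⟨subset_tsupport _ (left_ne_zero_of_mul hy),
        subset_tsupport _ (right_ne_zero_of_mul hy)⟩)
      ((isClosed_tsupport _).prod (isClosed_tsupport _))
  exact
    { smooth := contDiff_energyTest hθ n
      compact := .of_isClosed_subset
        (hθc.isCompact.prod (hasCompactSupport_truncatedEnergy n).isCompact)
        (isClosed_tsupport _) hsupp
      support := hsupp.trans (prod_mono hθT (subset_univ _)) }

lemma fderiv_energyTest_apply (hθ : ContDiff ℝ ∞ θ) (n : ℕ) (y v : ℝ × V3 × V3) :
    fderiv ℝ (energyTest θ n) y v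
      = deriv θ y.1 * (truncatedEnergy n y.2 * v.1)
        + θ y.1 * fderiv ℝ (truncatedEnergy n) y.2 v.2 := by
  have htime : HasFDerivAt (fun y : ℝ × V3 × V3 => θ y.1) _ y :=
    (hθ.differentiable (by simp) y.1).hasFDerivAt.comp y hasFDerivAt_fst
  have hspace : HasFDerivAt (fun y : ℝ × V3 × V3 => truncatedEnergy n y.2) _ y :=
    ((contDiff_truncatedEnergy n).differentiable (by simp) y.2).hasFDerivAt.comp y hasFDerivAt_snd
  have hprod : HasFDerivAt (energyTest θ n) _ y := htime.mul hspace
  rw [hprod.fderiv]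
  simp only [add_apply, smul_apply, ContinuousLinearMap.comp_apply, ContinuousLinearMap.coe_fst',
    ContinuousLinearMap.coe_snd', smul_eq_mul, fderiv_eq_smul_deriv]
  ring

lemma exists_norm_fderiv_energyTest_apply_le (hθ : ContDiff ℝ ∞ θ) (hθc : HasCompactSupport θ) :
    ∃ L M : ℝ, ∀ (n : ℕ) (y v : ℝ × V3 × V3),
      ‖fderiv ℝ (energyTest θ n) y v‖ ≤ L * ‖energy y.2.2 * v.1‖ + M * ‖v.2‖ := by
  obtain ⟨L, hL⟩ := (hθ.continuous_deriv (by simp)).bounded_above_of_compact_support hθc.deriv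
  obtain ⟨N, hN⟩ := hθ.continuous.bounded_above_of_compact_support hθc
  obtain ⟨K, hK⟩ := exists_norm_fderiv_truncatedEnergy_le
  refine ⟨L, N * K, fun n y v => ?_⟩
  have hN_nonneg : 0 ≤ N := (norm_nonneg _).trans (hN 0)
  have hL_nonneg : 0 ≤ L := (norm_nonneg _).trans (hL 0)
  rw [fderiv_energyTest_apply hθ, mul_assoc N, norm_mul (energy _),
    Real.norm_of_nonneg (energy_pos _).le]
  refine norm_add_le_of_le ?_ ?_
  · rw [norm_mul, norm_mul]
    gcongr
    exacts [hL _, norm_truncatedEnergy_le _ _]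
  · rw [norm_mul]
    gcongr
    exacts [hN _, ContinuousLinearMap.le_of_opNorm_le _ (hK n y.2) _]

lemma tendsto_energyTest (θ : ℝ → ℝ) (y : ℝ × V3 × V3) :
    Filter.Tendsto (fun n => energyTest θ n y) Filter.atTop (nhds (θ y.1 * energy y.2.2)) := by
  refine tendsto_const_nhds.congr' ?_
  filter_upwards [eventually_truncatedEnergy_eventuallyEq y.2] with n hn
  rw [energyTest, hn.eq_of_nhds]

lemma tendsto_fderiv_energyTest_apply (hθ : ContDiff ℝ ∞ θ) (y v : ℝ × V3 × V3) :
    Filter.Tendsto (fun n => fderiv ℝ (energyTest θ n) y v) Filter.atTop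
      (nhds (deriv θ y.1 * (energy y.2.2 * v.1) + θ y.1 * inner ℝ (vel y.2.2) v.2.2)) := by
  refine tendsto_const_nhds.congr' ?_
  filter_upwards [eventually_truncatedEnergy_eventuallyEq y.2] with n hn
  rw [fderiv_energyTest_apply hθ, hn.eq_of_nhds, hn.fderiv_eq, (hasFDerivAt_energy_snd y.2).fderiv]
  rfl

section Flux

variable {ν : Measure (ℝ × V3 × V3)} {r : ℝ × V3 × V3 → ℝ} {F : ℝ × V3 × V3 → V3 × V3}

lemma aestronglyMeasurable_fderiv_energyTest (hθ : ContDiff ℝ ∞ θ)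
    (hr : AEStronglyMeasurable r ν) (hF : AEStronglyMeasurable F ν) (n : ℕ) :
    AEStronglyMeasurable (fun y => fderiv ℝ (energyTest θ n) y (r y, F y)) ν :=
  (isBoundedBilinearMap_apply (𝕜 := ℝ)).continuous.comp_aestronglyMeasurable
    (((contDiff_energyTest hθ n).continuous_fderiv (by simp)).aestronglyMeasurable.prodMk
      (hr.prodMk hF))

lemma integrable_fderiv_energyTest (hθ : ContDiff ℝ ∞ θ) (hθc : HasCompactSupport θ)
    (hr : AEStronglyMeasurable r ν) (hεr : Integrable (fun y => energy y.2.2 * r y) ν)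
    (hF : Integrable F ν) (n : ℕ) :
    Integrable (fun y => fderiv ℝ (energyTest θ n) y (r y, F y)) ν := by
  obtain ⟨L, M, hLM⟩ := exists_norm_fderiv_energyTest_apply_le hθ hθc
  exact ((hεr.norm.const_mul L).add (hF.norm.const_mul M)).mono'
    (aestronglyMeasurable_fderiv_energyTest hθ hr hF.1 n) (.of_forall fun y => hLM n y _)

theorem tendsto_integral_fderiv_energyTest (hθ : ContDiff ℝ ∞ θ) (hθc : HasCompactSupport θ)
    (hr : AEStronglyMeasurable r ν) (hεr : Integrable (fun y => energy y.2.2 * r y) ν)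
    (hF : Integrable F ν) :
    Filter.Tendsto (fun n => ∫ y, fderiv ℝ (energyTest θ n) y (r y, F y) ∂ν) Filter.atTop
      (nhds (∫ y, (deriv θ y.1 * (energy y.2.2 * r y)
        + θ y.1 * inner ℝ (vel y.2.2) (F y).2) ∂ν)) := by
  obtain ⟨L, M, hLM⟩ := exists_norm_fderiv_energyTest_apply_le hθ hθc
  exact tendsto_integral_of_dominated_convergence
    (fun y => L * ‖energy y.2.2 * r y‖ + M * ‖F y‖)
    (aestronglyMeasurable_fderiv_energyTest hθ hr hF.1)
    ((hεr.norm.const_mul L).add (hF.norm.const_mul M)) (fun n => .of_forall fun y => hLM n y _)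
    (.of_forall fun y => tendsto_fderiv_energyTest_apply hθ y _)

end Flux

lemma tendsto_integral_mul_energyTest_zero {g : V3 × V3 → ℝ} (hg : AEStronglyMeasurable g)
    (hεg : Integrable fun z : V3 × V3 => energy z.2 * g z) (hθ : ContDiff ℝ ∞ θ) :
    Filter.Tendsto (fun n => ∫ z : V3 × V3, g z * energyTest θ n (0, z)) Filter.atTop
      (nhds (θ 0 * ∫ z : V3 × V3, energy z.2 * g z)) := by
  have hlim : ∀ z : V3 × V3, Filter.Tendsto (fun n => g z * energyTest θ n (0, z)) Filter.atTop
      (nhds (θ 0 * (energy z.2 * g z))) := fun z => by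
    convert (tendsto_energyTest θ (0, z)).const_mul (g z) using 2
    ring
  rw [← integral_const_mul]
  refine tendsto_integral_of_dominated_convergence (fun z => ‖θ 0‖ * ‖energy z.2 * g z‖)
    (fun n => hg.mul ?_) (hεg.norm.const_mul _) (fun n => .of_forall fun z => ?_)
    (.of_forall hlim)
  · exact ((contDiff_energyTest hθ n).continuous.comp (by fun_prop)).aestronglyMeasurable
  · rw [energyTest, norm_mul, norm_mul, norm_mul, Real.norm_of_nonneg (energy_pos _).le,
      mul_left_comm, mul_comm ‖g z‖]
    gcongr
    exact norm_truncatedEnergy_le n z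

end TruncatedEnergy

section MomentBound

variable {X P : Type*} [MeasurableSpace X] [NormedAddCommGroup P]

-- Small momenta are controlled by the bound `C` on `g`, large momenta by the moment of `g`.
lemma mul_le_add_indicator_ball_add_moment {lam : ℝ} (hlam : 0 ≤ lam) {a g C : ℝ≥0∞} (hC : g ≤ C)
    (p : P) :
    a * g ≤ g + a ^ 2 * (Metric.ball 0 1).indicator (fun _ => C) p + a * (‖p‖ₑ ^ lam * g) := by
  by_cases hp : p ∈ Metric.ball 0 1
  · rw [indicator_of_mem hp]
    refine le_add_right ?_
    rcases le_total a 1 with ha | ha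
    · exact le_add_right (mul_le_of_le_one_left' ha)
    · exact le_add_left (mul_le_mul' (le_self_pow₀ ha two_ne_zero) hC)
  · have hp_norm : 1 ≤ ‖p‖ₑ := by
      rw [mem_ball_zero_iff, not_lt] at hp
      rwa [← ofReal_norm, ENNReal.one_le_ofReal]
    refine le_add_left (mul_le_mul_right (le_mul_of_one_le_left' ?_) a)
    simpa only [ENNReal.one_rpow] using ENNReal.rpow_le_rpow hp_norm hlam

lemma lintegral_mul_le_eLpNorm_two_mul_eLpNorm_two {μ : Measure X} {a b : X → ℝ≥0∞}
    (ha : AEMeasurable a μ) (hb : AEMeasurable b μ) :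
    ∫⁻ x, a x * b x ∂μ ≤ eLpNorm a 2 μ * eLpNorm b 2 μ := by
  simpa only [eLpNorm_eq_lintegral_rpow_enorm_toReal two_ne_zero ENNReal.ofNat_ne_top,
    enorm_eq_self, ENNReal.toReal_ofNat, Pi.mul_apply]
    using ENNReal.lintegral_mul_le_Lp_mul_Lq μ .two_two ha hb

lemma lintegral_fst_mul_le_of_moment [MeasurableSpace P] [OpensMeasurableSpace P]
    {μ : Measure X} [SFinite μ] {ν : Measure P} [SFinite ν] {lam : ℝ} (hlam : 0 ≤ lam)
    {a : X → ℝ≥0∞} (ha : AEMeasurable a μ) {g : X × P → ℝ≥0∞} (hg : AEMeasurable g (μ.prod ν))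
    {C : ℝ≥0∞} (hC : ∀ᵐ z ∂(μ.prod ν), g z ≤ C) :
    ∫⁻ z, a z.1 * g z ∂(μ.prod ν)
      ≤ ∫⁻ z, g z ∂(μ.prod ν) + eLpNorm a 2 μ ^ 2 * (C * ν (Metric.ball 0 1))
        + eLpNorm a 2 μ * eLpNorm (fun x => ∫⁻ p, ‖p‖ₑ ^ lam * g (x, p) ∂ν) 2 μ := by
  set b : P → ℝ≥0∞ := (Metric.ball 0 1).indicator fun _ => C
  have hb : Measurable b := measurable_const.indicator measurableSet_ball
  have hsmall : AEMeasurable (fun z : X × P => a z.1 ^ 2 * b z.2) (μ.prod ν) :=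
    (ha.comp_fst.pow_const 2).mul (hb.comp measurable_snd).aemeasurable
  have hmoment : AEMeasurable (fun z : X × P => ‖z.2‖ₑ ^ lam * g z) (μ.prod ν) :=
    (measurable_snd.enorm.pow_const lam).aemeasurable.mul hg
  have hsmall_eq : ∫⁻ z, a z.1 ^ 2 * b z.2 ∂(μ.prod ν)
      = eLpNorm a 2 μ ^ 2 * (C * ν (Metric.ball 0 1)) := by
    rw [lintegral_prod_mul (ha.pow_const 2) hb.aemeasurable,
      lintegral_indicator_const measurableSet_ball]
    congr 1
    simpa using (eLpNorm_nnreal_pow_eq_lintegral (μ := μ) (f := a) (p := 2) two_ne_zero).symm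
  have hlarge_le : ∫⁻ z, a z.1 * (‖z.2‖ₑ ^ lam * g z) ∂(μ.prod ν)
      ≤ eLpNorm a 2 μ * eLpNorm (fun x => ∫⁻ p, ‖p‖ₑ ^ lam * g (x, p) ∂ν) 2 μ := by
    refine le_trans (le_of_eq ?_)
      (lintegral_mul_le_eLpNorm_two_mul_eLpNorm_two ha hmoment.lintegral_prod_right')
    rw [lintegral_prod (fun z => a z.1 * (‖z.2‖ₑ ^ lam * g z)) (ha.comp_fst.mul hmoment)]
    refine lintegral_congr_ae ?_
    filter_upwards [hmoment.aestronglyMeasurable.prodMk_left] with x hx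
    exact lintegral_const_mul'' _ hx.aemeasurable
  calc ∫⁻ z, a z.1 * g z ∂(μ.prod ν)
      ≤ ∫⁻ z, (g z + a z.1 ^ 2 * b z.2 + a z.1 * (‖z.2‖ₑ ^ lam * g z)) ∂(μ.prod ν) :=
        lintegral_mono_ae (hC.mono fun z hz => mul_le_add_indicator_ball_add_moment hlam hz z.2)
    _ = ∫⁻ z, g z ∂(μ.prod ν) + ∫⁻ z, a z.1 ^ 2 * b z.2 ∂(μ.prod ν)
          + ∫⁻ z, a z.1 * (‖z.2‖ₑ ^ lam * g z) ∂(μ.prod ν) := by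
        simp_rw [add_assoc]
        rw [lintegral_add_left' hg, lintegral_add_left' hsmall]
    _ ≤ _ := by rw [hsmall_eq]; gcongr

end MomentBound

lemma integrable_prod_of_ae_lintegral_enorm_le {X Y F : Type*} [MeasurableSpace X]
    [MeasurableSpace Y] [NormedAddCommGroup F] {μ : Measure X} [IsFiniteMeasure μ] {ν : Measure Y}
    [SFinite ν] {w : X × Y → F} (hw : AEStronglyMeasurable w (μ.prod ν)) {C : ℝ≥0∞} (hC : C ≠ ⊤)
    (h : ∀ᵐ x ∂μ, ∫⁻ y, ‖w (x, y)‖ₑ ∂ν ≤ C) : Integrable w (μ.prod ν) := by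
  refine ⟨hw, ?_⟩
  rw [HasFiniteIntegral, lintegral_prod _ hw.enorm]
  calc ∫⁻ x, ∫⁻ y, ‖w (x, y)‖ₑ ∂ν ∂μ ≤ ∫⁻ _, C ∂μ := lintegral_mono_ae h
    _ < ⊤ := by
      rw [lintegral_const]
      exact ENNReal.mul_lt_top hC.lt_top (measure_lt_top _ _)

section ProdAssoc

variable {X Y Z F : Type*} [MeasurableSpace X] [MeasurableSpace Y] [MeasurableSpace Z]
  {μ : Measure X} {ν : Measure Y} {τ : Measure Z} [SFinite ν] [SFinite τ]

lemma integrable_prodAssoc [NormedAddCommGroup F] {w : X × Y × Z → F}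
    (hw : Integrable w (μ.prod (ν.prod τ))) :
    Integrable (fun y : (X × Y) × Z => w (y.1.1, y.1.2, y.2)) ((μ.prod ν).prod τ) :=
  (measurePreserving_prodAssoc μ ν τ).integrable_comp_of_integrable hw

lemma aestronglyMeasurable_comp_fst_snd_fst [TopologicalSpace F] {u : X → Y → F}
    (hu : AEStronglyMeasurable (fun z : X × Y => u z.1 z.2) (μ.prod ν)) :
    AEStronglyMeasurable (fun y : X × Y × Z => u y.1 y.2.1) (μ.prod (ν.prod τ)) :=
  hu.comp_quasiMeasurePreserving (f := fun y : X × Y × Z => (y.1, y.2.1))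
    ((Measure.quasiMeasurePreserving_fst (μ := μ.prod ν) (ν := τ)).comp
      ((measurePreserving_prodAssoc μ ν τ).symm MeasurableEquiv.prodAssoc).quasiMeasurePreserving)

end ProdAssoc

section Integrability

lemma MemL1Kin.lintegral_enorm_energy_mul {g : V3 × V3 → ℝ} (hg : MemL1Kin g) :
    ∫⁻ z : V3 × V3, ‖energy z.2 * g z‖ₑ = ENNReal.ofReal (∫ z : V3 × V3, energy z.2 * g z) := by
  rw [← ofReal_integral_norm_eq_lintegral_enorm hg.energy_integrable]
  refine congrArg _ (integral_congr_ae ?_)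
  filter_upwards [hg.nonneg] with z hz
  exact Real.norm_of_nonneg (mul_nonneg (energy_pos _).le hz)

lemma MemL1Kin.lintegral_enorm_norm_fst_mul_le {g : V3 × V3 → ℝ} (hg : MemL1Kin g) {lam : ℝ}
    (hlam : 0 ≤ lam) {u : V3 → V3} (hu : AEStronglyMeasurable u) :
    ∫⁻ z : V3 × V3, ‖‖u z.1‖ * g z‖ₑ
      ≤ (∫⁻ z : V3 × V3, ‖energy z.2 * g z‖ₑ)
        + eLpNorm u 2 ^ 2 * (eLpNorm g ⊤ * volume (Metric.ball (0 : V3) 1))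
        + eLpNorm u 2 * eLpNorm (fun x => ∫⁻ p : V3, ENNReal.ofReal (‖p‖ ^ lam * g (x, p))) 2 := by
  have hmoment : ∀ x p, ENNReal.ofReal (‖p‖ ^ lam * g (x, p))
      = ‖p‖ₑ ^ lam * ENNReal.ofReal (g (x, p)) := fun x p => by
    rw [ENNReal.ofReal_mul (by positivity), ← ENNReal.ofReal_rpow_of_nonneg (norm_nonneg _) hlam,
      ofReal_norm]
  have hbound : ∀ᵐ z, ENNReal.ofReal (g z) ≤ eLpNorm g ⊤ := by
    filter_upwards [enorm_ae_le_eLpNormEssSup g volume] with z hz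
    exact (Real.ofReal_le_enorm _).trans (hz.trans_eq eLpNorm_exponent_top.symm)
  have henergy : ∀ z : V3 × V3, ENNReal.ofReal (g z) ≤ ‖energy z.2 * g z‖ₑ := fun z => by
    rw [enorm_mul, Real.enorm_of_nonneg (energy_pos _).le]
    exact (Real.ofReal_le_enorm _).trans
      (le_mul_of_one_le_left' (ENNReal.one_le_ofReal.2 (one_le_energy _)))
  calc ∫⁻ z : V3 × V3, ‖‖u z.1‖ * g z‖ₑ
      = ∫⁻ z : V3 × V3, ‖u z.1‖ₑ * ENNReal.ofReal (g z) := by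
        refine lintegral_congr_ae ?_
        filter_upwards [hg.nonneg] with z hz
        rw [enorm_mul, enorm_norm, Real.enorm_of_nonneg hz]
    _ ≤ _ := lintegral_fst_mul_le_of_moment hlam hu.enorm
        hg.integrable.aemeasurable.ennreal_ofReal hbound
    _ ≤ _ := by
        simp_rw [hmoment, eLpNorm_enorm]
        rw [← Measure.volume_eq_prod]
        gcongr with z
        exact henergy z

variable {T : ℝ} {f : ℝ → V3 × V3 → ℝ}

lemma MemLinftyKin.integrable_energy_mul (hf : MemLinftyKin T f) :
    Integrable (fun y : ℝ × V3 × V3 => energy y.2.2 * f y.1 y.2)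
      ((volume.restrict (Ioo 0 T)).prod volume) := by
  obtain ⟨C, hC⟩ := hf.bound
  refine integrable_prod_of_ae_lintegral_enorm_le (C := C)
    ((contDiff_energy.continuous.comp (by fun_prop)).aestronglyMeasurable.mul hf.measurable)
    ENNReal.coe_ne_top ?_
  filter_upwards [hf.mem, hC] with t ht htC
  rw [ht.1.lintegral_enorm_energy_mul]
  exact ENNReal.ofReal_le_of_le_toReal htC.1

lemma MemLinftyKin.integrable_norm_mul {lam : ℝ} (hlam : 0 ≤ lam) (hf : MemLinftyKin T f)
    {u : ℝ → V3 → V3} (hu : MemLinftyL2 T u)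
    (hrho : ∃ C : ℝ≥0, ∀ᵐ t ∂(volume.restrict (Ioo 0 T)),
      eLpNorm (rhoMoment lam f t) 2 volume ≤ C) :
    Integrable (fun y : ℝ × V3 × V3 => ‖u y.1 y.2.1‖ * f y.1 y.2)
      ((volume.restrict (Ioo 0 T)).prod volume) := by
  obtain ⟨C, hC⟩ := hf.bound
  obtain ⟨A, hA⟩ := hu.bound
  obtain ⟨D, hD⟩ := hrho
  refine integrable_prod_of_ae_lintegral_enorm_le
    (C := C + A ^ 2 * (C * volume (Metric.ball (0 : V3) 1)) + A * D)
    ((aestronglyMeasurable_comp_fst_snd_fst hu.measurable).norm.mul hf.measurable) ?_ ?_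
  · have hball : volume (Metric.ball (0 : V3) 1) ≠ ⊤ := measure_ball_lt_top.ne
    finiteness
  · filter_upwards [hf.mem, hC, hA, hD, hu.measurable.prodMk_left] with t ht htC htA htD htu
    have henergy : ∫⁻ z : V3 × V3, ‖energy z.2 * f t z‖ₑ ≤ C :=
      ht.1.lintegral_enorm_energy_mul.trans_le (ENNReal.ofReal_le_of_le_toReal htC.1)
    refine (ht.1.lintegral_enorm_norm_fst_mul_le hlam htu).trans ?_
    gcongr
    exacts [htC.2, htD]

end Integrability

section PhaseFlux

/-- The velocity field `(v, K)` which transports the distribution function in phase space, at the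
time-phase point `(t, x, p)`. -/
noncomputable def phaseVelocity (E B : ℝ → V3 → V3) (y : ℝ × V3 × V3) : V3 × V3 :=
  (vel y.2.2, lorentz E B y.1 y.2.1 y.2.2)

lemma norm_phaseVelocity_le (E B : ℝ → V3 → V3) (y : ℝ × V3 × V3) :
    ‖phaseVelocity E B y‖ ≤ 1 + ‖E y.1 y.2.1‖ + ‖B y.1 y.2.1‖ := by
  have hv := norm_vel_le_one y.2.2
  have hK := norm_lorentz_le E B y.1 y.2.1 y.2.2
  have hEB : 0 ≤ ‖E y.1 y.2.1‖ + ‖B y.1 y.2.1‖ := by positivity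
  exact norm_prod_le_iff.2 ⟨hv.trans (by linarith), hK.trans (by linarith)⟩

lemma inner_vel_smul_phaseVelocity (E B : ℝ → V3 → V3) (y : ℝ × V3 × V3) (r : ℝ) :
    inner ℝ (vel y.2.2) (r • phaseVelocity E B y).2
      = r * inner ℝ (E y.1 y.2.1) (vel y.2.2) := by
  rw [Prod.smul_snd, real_inner_smul_right, phaseVelocity, inner_vel_lorentz]

lemma aestronglyMeasurable_vel_snd_snd {ν : Measure (ℝ × V3 × V3)} :
    AEStronglyMeasurable (fun y => vel y.2.2) ν :=
  (continuous_vel.comp (continuous_snd.comp continuous_snd)).aestronglyMeasurable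

lemma integrable_power {ν : Measure (ℝ × V3 × V3)} {f : ℝ → V3 × V3 → ℝ} {E B : ℝ → V3 → V3}
    (hflux : Integrable (fun y : ℝ × V3 × V3 => f y.1 y.2 • phaseVelocity E B y) ν) :
    Integrable (fun y : ℝ × V3 × V3 => f y.1 y.2 * inner ℝ (E y.1 y.2.1) (vel y.2.2)) ν := by
  simp_rw [← inner_vel_smul_phaseVelocity E B]
  refine hflux.mono (aestronglyMeasurable_vel_snd_snd.inner hflux.1.snd) (.of_forall fun y => ?_)
  calc _ ≤ ‖vel y.2.2‖ * ‖(f y.1 y.2 • phaseVelocity E B y).2‖ := norm_inner_le_norm _ _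
    _ ≤ ‖(f y.1 y.2 • phaseVelocity E B y).2‖ :=
        mul_le_of_le_one_left (norm_nonneg _) (norm_vel_le_one _)
    _ ≤ ‖f y.1 y.2 • phaseVelocity E B y‖ := norm_snd_le _

variable {μ : Measure ℝ} {f : ℝ → V3 × V3 → ℝ} {E B : ℝ → V3 → V3}

lemma aestronglyMeasurable_phaseVelocity
    (hE : AEStronglyMeasurable (fun z : ℝ × V3 => E z.1 z.2) (μ.prod volume))
    (hB : AEStronglyMeasurable (fun z : ℝ × V3 => B z.1 z.2) (μ.prod volume)) :
    AEStronglyMeasurable (phaseVelocity E B) (μ.prod volume) := by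
  have hB_lift : AEStronglyMeasurable (fun y : ℝ × V3 × V3 => B y.1 y.2.1) (μ.prod volume) :=
    aestronglyMeasurable_comp_fst_snd_fst hB
  have hcross := continuous_cross.comp_aestronglyMeasurable
    (aestronglyMeasurable_vel_snd_snd.prodMk hB_lift)
  have hK : AEStronglyMeasurable (fun y : ℝ × V3 × V3 => lorentz E B y.1 y.2.1 y.2.2)
      (μ.prod volume) := by
    unfold lorentz
    exact (aestronglyMeasurable_comp_fst_snd_fst hE).add hcross
  exact aestronglyMeasurable_vel_snd_snd.prodMk hK

lemma integrable_smul_phaseVelocity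
    (hf : Integrable (fun y : ℝ × V3 × V3 => f y.1 y.2) (μ.prod volume))
    (hE : AEStronglyMeasurable (fun z : ℝ × V3 => E z.1 z.2) (μ.prod volume))
    (hB : AEStronglyMeasurable (fun z : ℝ × V3 => B z.1 z.2) (μ.prod volume))
    (hEf : Integrable (fun y : ℝ × V3 × V3 => ‖E y.1 y.2.1‖ * f y.1 y.2) (μ.prod volume))
    (hBf : Integrable (fun y : ℝ × V3 × V3 => ‖B y.1 y.2.1‖ * f y.1 y.2) (μ.prod volume)) :
    Integrable (fun y : ℝ × V3 × V3 => f y.1 y.2 • phaseVelocity E B y) (μ.prod volume) := by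
  refine ((hf.norm.add hEf.norm).add hBf.norm).mono'
    (hf.1.smul (aestronglyMeasurable_phaseVelocity hE hB)) (.of_forall fun y => ?_)
  calc ‖f y.1 y.2 • phaseVelocity E B y‖
      ≤ ‖f y.1 y.2‖ * (1 + ‖E y.1 y.2.1‖ + ‖B y.1 y.2.1‖) := by
        rw [norm_smul]
        gcongr
        exact norm_phaseVelocity_le E B y
    _ = ‖f y.1 y.2‖ + ‖‖E y.1 y.2.1‖ * f y.1 y.2‖ + ‖‖B y.1 y.2.1‖ * f y.1 y.2‖ := by
        simp only [norm_mul, norm_norm]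
        ring

lemma VlasovWeak.integral_fderiv_flux {T : ℝ} {f₀ : V3 × V3 → ℝ} (hV : VlasovWeak T f₀ f E B)
    {φ : ℝ × V3 × V3 → ℝ} (hφ : IsTest T φ) :
    ∫ t in Ioo 0 T, ∫ z : V3 × V3,
        fderiv ℝ φ (t, z) (f t z, f t z • phaseVelocity E B (t, z))
      = - ∫ z : V3 × V3, f₀ z * φ (0, z) := by
  rw [← hV φ hφ]
  congr! 4 with t z
  rw [← map_add, ← map_add, ← smul_eq_mul, ← map_smul]
  simp [phaseVelocity]

end PhaseFlux

section Current

lemma inner_current_eq {f : ℝ → V3 × V3 → ℝ} {t : ℝ} {x : V3}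
    (hf : Integrable fun p => f t (x, p)) (a : V3) :
    inner ℝ a (current f t x) = ∫ p, f t (x, p) * inner ℝ a (vel p) := by
  have hfv : Integrable fun p => f t (x, p) • vel p :=
    hf.smul_bdd 1 continuous_vel.aestronglyMeasurable (.of_forall norm_vel_le_one)
  rw [current, ← integral_inner hfv]
  simp_rw [real_inner_smul_right]

variable {μ : Measure ℝ} [SFinite μ] {f : ℝ → V3 × V3 → ℝ} {E : ℝ → V3 → V3}

lemma ae_inner_current_eq
    (hf : Integrable (fun y : ℝ × V3 × V3 => f y.1 y.2) (μ.prod volume)) :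
    ∀ᵐ z ∂(μ.prod (volume : Measure V3)), inner ℝ (E z.1 z.2) (current f z.1 z.2)
        = ∫ p, f z.1 (z.2, p) * inner ℝ (E z.1 z.2) (vel p) := by
  filter_upwards [(integrable_prodAssoc hf).prod_right_ae] with z hz
  exact inner_current_eq hz _

lemma integrable_inner_current
    (hf : Integrable (fun y : ℝ × V3 × V3 => f y.1 y.2) (μ.prod volume))
    (hpower : Integrable (fun y : ℝ × V3 × V3 => f y.1 y.2 * inner ℝ (E y.1 y.2.1) (vel y.2.2))
      (μ.prod volume)) :
    Integrable (fun z : ℝ × V3 => inner ℝ (E z.1 z.2) (current f z.1 z.2)) (μ.prod volume) :=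
  (integrable_prodAssoc hpower).integral_prod_left.congr
    ((ae_inner_current_eq hf).mono fun _ hz => hz.symm)

lemma ae_integral_power_eq
    (hf : Integrable (fun y : ℝ × V3 × V3 => f y.1 y.2) (μ.prod volume))
    (hpower : Integrable (fun y : ℝ × V3 × V3 => f y.1 y.2 * inner ℝ (E y.1 y.2.1) (vel y.2.2))
      (μ.prod volume)) :
    ∀ᵐ t ∂μ, ∫ z : V3 × V3, f t z * inner ℝ (E t z.1) (vel z.2)
        = ∫ x, inner ℝ (E t x) (current f t x) := by
  filter_upwards [hpower.prod_right_ae, Measure.ae_ae_of_ae_prod (ae_inner_current_eq (E := E) hf)]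
    with t ht htx
  rw [Measure.volume_eq_prod, integral_prod _ ht]
  exact integral_congr_ae (htx.mono fun x hx => hx.symm)

end Current

lemma integral_prod_mul_add_mul {X Y : Type*} [MeasurableSpace X] [MeasurableSpace Y]
    {μ : Measure X} [SFinite μ] {ν : Measure Y} [SFinite ν] {a b : X → ℝ} {w u : X × Y → ℝ}
    (hw : Integrable (fun z => a z.1 * w z) (μ.prod ν))
    (hu : Integrable (fun z => b z.1 * u z) (μ.prod ν)) :
    ∫ z, (a z.1 * w z + b z.1 * u z) ∂(μ.prod ν)
      = ∫ x, (a x * ∫ y, w (x, y) ∂ν + b x * ∫ y, u (x, y) ∂ν) ∂μ := by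
  rw [integral_prod (fun z : X × Y => a z.1 * w z + b z.1 * u z) (hw.add hu)]
  refine integral_congr_ae ?_
  filter_upwards [hw.prod_right_ae, hu.prod_right_ae] with x hwx hux
  rw [integral_add hwx hux, integral_const_mul, integral_const_mul]

section EnergyBalance

variable {T : ℝ} {f₀ : V3 × V3 → ℝ} {f : ℝ → V3 × V3 → ℝ} {E B : ℝ → V3 → V3}

lemma MemLinftyKin.integrable (hf : MemLinftyKin T f) :
    Integrable (fun y : ℝ × V3 × V3 => f y.1 y.2) ((volume.restrict (Ioo 0 T)).prod volume) := by
  refine hf.integrable_energy_mul.mono hf.measurable (.of_forall fun y => ?_)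
  rw [norm_mul, Real.norm_of_nonneg (energy_pos _).le]
  exact le_mul_of_one_le_left (norm_nonneg _) (one_le_energy _)

lemma weak_energy_balance (hf₀ : MemL1Kin f₀) (hf : MemLinftyKin T f)
    (hV : VlasovWeak T f₀ f E B)
    (hflux : Integrable (fun y : ℝ × V3 × V3 => f y.1 y.2 • phaseVelocity E B y)
      ((volume.restrict (Ioo 0 T)).prod volume))
    {θ : ℝ → ℝ} (hθ : ContDiff ℝ ∞ θ) (hθc : HasCompactSupport θ) (hθT : tsupport θ ⊆ Iio T) :
    ∫ t in Ioo 0 T, (deriv θ t * (∫ z : V3 × V3, energy z.2 * f t z)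
        + θ t * ∫ x, inner ℝ (E t x) (current f t x))
      = -(θ 0 * ∫ z : V3 × V3, energy z.2 * f₀ z) := by
  have hεf := hf.integrable_energy_mul
  have hpower := integrable_power hflux
  obtain ⟨b, hb⟩ := hθ.continuous.bounded_above_of_compact_support hθc
  obtain ⟨b', hb'⟩ := (hθ.continuous_deriv (by simp)).bounded_above_of_compact_support hθc.deriv
  have hbalance : ∀ n, ∫ y, fderiv ℝ (energyTest θ n) y (f y.1 y.2, f y.1 y.2 • phaseVelocity E B y)
        ∂((volume.restrict (Ioo 0 T)).prod volume)
      = - ∫ z : V3 × V3, f₀ z * energyTest θ n (0, z) := fun n =>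
    (integral_prod _ (integrable_fderiv_energyTest hθ hθc hf.measurable hεf hflux n)).trans
      (hV.integral_fderiv_flux (isTest_energyTest hθ hθc hθT n))
  have hlim := tendsto_integral_fderiv_energyTest hθ hθc hf.measurable hεf hflux
  simp_rw [hbalance, inner_vel_smul_phaseVelocity] at hlim
  calc _ = ∫ t in Ioo 0 T, (deriv θ t * (∫ z : V3 × V3, energy z.2 * f t z)
          + θ t * ∫ z : V3 × V3, f t z * inner ℝ (E t z.1) (vel z.2)) := by
        refine integral_congr_ae ((ae_integral_power_eq hf.integrable hpower).mono fun t ht => ?_)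
        simp only [ht]
    _ = ∫ y : ℝ × V3 × V3, (deriv θ y.1 * (energy y.2.2 * f y.1 y.2)
          + θ y.1 * (f y.1 y.2 * inner ℝ (E y.1 y.2.1) (vel y.2.2)))
            ∂((volume.restrict (Ioo 0 T)).prod volume) :=
        (integral_prod_mul_add_mul
          (hεf.bdd_mul ((hθ.continuous_deriv (by simp)).comp continuous_fst).aestronglyMeasurable
            (.of_forall fun y => hb' y.1))
          (hpower.bdd_mul (hθ.continuous.comp continuous_fst).aestronglyMeasurable
            (.of_forall fun y => hb y.1))).symm
    _ = _ := tendsto_nhds_unique hlim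
        (tendsto_integral_mul_energyTest_zero hf₀.integrable.1 hf₀.energy_integrable hθ).neg

end EnergyBalance

end RVM

open RVM in
theorem lemma3_general {T lam : ℝ} (hT : 0 < T) (hlam : 0 ≤ lam) {f₀ : V3 × V3 → ℝ}
    (hf₀ : MemL1Kin f₀) {f : ℝ → V3 × V3 → ℝ} {E B : ℝ → V3 → V3} (hf : MemLinftyKin T f)
    (hE : MemLinftyL2 T E) (hB : MemLinftyL2 T B) (hV : VlasovWeak T f₀ f E B)
    (hrho : ∃ C : ℝ≥0, ∀ᵐ t ∂(volume.restrict (Ioo 0 T)),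
      eLpNorm (rhoMoment lam f t) 2 volume ≤ C) :
    Integrable (fun z : ℝ × V3 => inner ℝ (E z.1 z.2) (current f z.1 z.2))
        ((volume.restrict (Ioo 0 T)).prod volume) ∧
      ∀ᵐ t ∂(volume.restrict (Ico 0 T)),
        ∫ z : V3 × V3, energy z.2 * f t z
          = (∫ z : V3 × V3, energy z.2 * f₀ z)
            + ∫ s in (0 : ℝ)..t, ∫ x : V3, inner ℝ (E s x) (current f s x) := by
  have hflux := integrable_smul_phaseVelocity hf.integrable hE.measurable hB.measurable
    (hf.integrable_norm_mul hlam hE hrho) (hf.integrable_norm_mul hlam hB hrho)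
  have hEj := integrable_inner_current hf.integrable (integrable_power hflux)
  refine ⟨hEj, ?_⟩
  rw [← restrict_Ioo_eq_restrict_Ico]
  exact ae_eq_add_integral_of_weak_deriv hT hf.integrable_energy_mul.integral_prod_left
    hEj.integral_prod_left fun θ hθ hθc hθT =>
      weak_energy_balance hf₀ hf hV hflux hθ hθc hθT

theorem lemma3 (T lam : ℝ) (hT : 0 < T) (hlam : 0 < lam)
    (f₀ : RVM.V3 × RVM.V3 → ℝ) (E₀ B₀ : RVM.V3 → RVM.V3)
    (hf₀ : RVM.MemL1Kin f₀) (hf₀_bdd : MemLp f₀ ⊤) (hE₀ : MemLp E₀ 2) (hB₀ : MemLp B₀ 2)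
    (f : ℝ → RVM.V3 × RVM.V3 → ℝ) (E B : ℝ → RVM.V3 → RVM.V3)
    (hsol : RVM.IsWeakSolution T f₀ E₀ B₀ f E B)
    (hE : ∀ i : Fin 3, RVM.MemL1BVLoc T (fun t x => E t x i))
    (hB : ∀ i : Fin 3, RVM.MemL1BVLoc T (fun t x => B t x i))
    (hrho : ∃ C : ℝ≥0, ∀ᵐ t ∂(volume.restrict (Ioo 0 T)),
      eLpNorm (RVM.rhoMoment lam f t) 2 volume ≤ C) :
    Integrable (fun z : ℝ × RVM.V3 => inner ℝ (E z.1 z.2) (RVM.current f z.1 z.2))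
        ((volume.restrict (Ioo 0 T)).prod volume) ∧
      ∀ᵐ t ∂(volume.restrict (Ico 0 T)),
        ∫ z : RVM.V3 × RVM.V3, RVM.energy z.2 * f t z
          = (∫ z : RVM.V3 × RVM.V3, RVM.energy z.2 * f₀ z)
            + ∫ s in (0 : ℝ)..t, ∫ x : RVM.V3, inner ℝ (E s x) (RVM.current f s x) := by
  exact lemma3_general hT hlam.le hf₀ hsol.f_mem hsol.E_mem hsol.B_mem hsol.vlasov hrho
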